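/- Let $\mathsf{Func}_{n,m}$ be the set of all functions $\{0,1\}^n\to\{0,1\}^m$. For a deterministic algorithm $G:\{0,1\}^k\to\{0,1\}^\ell$ with classical access to an oracle $H\in\mathsf{Func}_{n,m}$, and an algorithm $\mathcal{D}$ with input in $\{0,1\}^\ell$, one-bit output and (classical or quantum) access to $H$, the distinguishing advantage of $\mathcal{D}$ relative to $G$ is $$\mathsf{Adv}_{\mathcal{D},G}=\Bigl|\Pr_{H\leftarrow\mathsf{Func}_{n,m},\,s\leftarrow\{0,1\}^k}\bigl[\mathcal{D}^{H}(G^{H}(s))=1\bigr]-\Pr_{H\leftarrow\mathsf{Func}_{n,m},\,g\leftarrow\{0,1\}^\ell}\bigl[\mathcal{D}^{H}(g)=1\bigr]\Bigr|,$$ where all choices are uniform and independent, and the probabilities are also over the internal randomness (or measurement outcome) of $\mathcal{D}$. A quantum query to $H$ is one application of the unitary $|x\rangle|y\rangle\mapsto|x\rangle|y\oplus H(x)\rangle$; a quantum algorithm making $Q$ queries starts from its input together with finitely many qubits in state $|0\rangle$, alternates $Q$ query unitaries with arbitrary unitaries that do not depend on $H$, and finally measures in the computational basis. Algorithms are computationally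 unbounded and only oracle queries are counted; a classical algorithm makes at most $Q$ queries if it does so for every input, oracle and internal randomness. **Theorem.** There is a polynomial $p$ in five variables, with real coefficients, such that the following holds for all $k,\ell,n,m,Q_G,Q_\mathcal{A}\in\mathbb{N}$. Let $G:\{0,1\}^k\to\{0,1\}^\ell$ be a deterministic algorithm making at most $Q_G$ classical queries to an oracle $H:\{0,1\}^n\to\{0,1\}^m$, let $\mathcal{A}$ be a quantum algorithm with input in $\{0,1\}^\ell$ and one-bit output making $Q_\mathcal{A}$ quantum queries to $H$, and suppose that $\epsilon=\mathsf{Adv}_{\mathcal{A},G}>0$. Then there is a randomized classical algorithm $\mathcal{B}$ making at most $p(k,n,Q_G,Q_\mathcal{A},1/\epsilon)$ classical queries to $H$ such that $\mathsf{Adv}_{\mathcal{B},G}\ge\epsilon/2$. -/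

import Mathlib

namespace LiftPRG

/-- Bit strings of length `n`. -/
abbrev BitStr (n : ℕ) : Type := Fin n → Bool

/-- All functions from `n`-bit strings to `m`-bit strings, i.e. the possible oracles. -/
abbrev Func (n m : ℕ) : Type := BitStr n → BitStr m

/-- Bitwise exclusive or. -/
def bxor {m : ℕ} (y z : BitStr m) : BitStr m := fun i => xor (y i) (z i)

theorem bxor_bxor_cancel {m : ℕ} (y z : BitStr m) : bxor (bxor y z) z = y := by
  funext i
  simp [bxor]

/-! ### Classical oracle algorithms -/

/-- A deterministic computation with classical access to an oracle `H : {0,1}^n → {0,1}^m`: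
it either stops with an output, or queries a point and continues adaptively with the answer.
There is no restriction on computing power; only oracle queries are counted. -/
inductive QueryTree (n m : ℕ) (α : Type) : Type
  | output (a : α) : QueryTree n m α
  | query (x : BitStr n) (next : BitStr m → QueryTree n m α) : QueryTree n m α

namespace QueryTree

variable {n m : ℕ} {α : Type}

/-- The result of the computation with oracle `H`. -/
def run : QueryTree n m α → Func n m → α
  | output a, _ => a
  | query x next, H => run (next (H x)) H

/-- The number of queries made by the computation when the oracle is `H`. -/
def numQueries : QueryTree n m α → Func n m → ℕ
  | output _, _ => 0
  | query x next, H => numQueries (next (H x)) H + 1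

end QueryTree

/-- A deterministic classical oracle algorithm `{0,1}^k → {0,1}^ℓ`. -/
abbrev DetAlg (n m k ℓ : ℕ) : Type := BitStr k → QueryTree n m (BitStr ℓ)

/-- On every input and for every oracle, `G` makes at most `Q` queries. -/
def DetAlg.MakesAtMost {n m k ℓ : ℕ} (G : DetAlg n m k ℓ) (Q : ℕ) : Prop :=
  ∀ (s : BitStr k) (H : Func n m), (G s).numQueries H ≤ Q

/-- A randomized classical oracle algorithm with input in `{0,1}^ℓ` and output one bit: on each
input, its internal randomness (independent of the oracle) selects a deterministic computation. -/
abbrev ClassicalDistinguisher (n m ℓ : ℕ) : Type := BitStr ℓ → PMF (QueryTree n m Bool)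

/-- On every input, for every outcome of the internal randomness and every oracle, `B` makes at
most `q` queries. -/
def ClassicalDistinguisher.MakesAtMost {n m ℓ : ℕ} (B : ClassicalDistinguisher n m ℓ) (q : ℕ) :
    Prop :=
  ∀ (g : BitStr ℓ), ∀ t ∈ (B g).support, ∀ H : Func n m, t.numQueries H ≤ q

/-- The probability that `B` outputs `1` on input `g` with classical access to `H`. -/
noncomputable def ClassicalDistinguisher.acceptProb {n m ℓ : ℕ}
    (B : ClassicalDistinguisher n m ℓ) (H : Func n m) (g : BitStr ℓ) : ℝ :=
  (((B g).map fun t => t.run H) true).toReal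

/-! ### Quantum oracle algorithms -/

/-- Labels of the computational basis of a system made of the query register (`n` qubits), the
answer register (`m` qubits), the input register (`ℓ` qubits), a workspace (`w` qubits) and an
output qubit. -/
abbrev QBasis (n m ℓ w : ℕ) : Type := BitStr n × BitStr m × BitStr ℓ × BitStr w × Bool

instance instDecidableEqQBasis (n m ℓ w : ℕ) : DecidableEq (QBasis n m ℓ w) :=
  letI : DecidableEq (BitStr ℓ × BitStr w × Bool) := inferInstance
  inferInstance

/-- The Hilbert space `ℂ^(2^(n+m+ℓ+w+1))`, with coordinates indexed by the computational basis. -/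
abbrev QSpace (n m ℓ w : ℕ) : Type := EuclideanSpace ℂ (QBasis n m ℓ w)

/-- The permutation `(x, y, …) ↦ (x, y ⊕ H x, …)` of the computational basis. -/
def oraclePerm {n m : ℕ} (H : Func n m) (ℓ w : ℕ) : Equiv.Perm (QBasis n m ℓ w) where
  toFun b := (b.1, bxor b.2.1 (H b.1), b.2.2)
  invFun b := (b.1, bxor b.2.1 (H b.1), b.2.2)
  left_inv b := by simp [bxor_bxor_cancel]
  right_inv b := by simp [bxor_bxor_cancel]

/-- The query unitary `|x⟩|y⟩ ↦ |x⟩|y ⊕ H x⟩`, acting as the identity on the other registers. -/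
noncomputable def oracleUnitary {n m : ℕ} (H : Func n m) (ℓ w : ℕ) :
    QSpace n m ℓ w ≃ₗᵢ[ℂ] QSpace n m ℓ w :=
  LinearIsometryEquiv.piLpCongrLeft 2 ℂ ℂ (oraclePerm H ℓ w)

theorem oracleUnitary_single {n m ℓ w : ℕ} (H : Func n m) (x : BitStr n) (y : BitStr m)
    (r : BitStr ℓ × BitStr w × Bool) :
    oracleUnitary H ℓ w (EuclideanSpace.single (x, y, r) 1) =
      EuclideanSpace.single (x, bxor y (H x), r) 1 :=
  LinearIsometryEquiv.piLpCongrLeft_single (oraclePerm H ℓ w) (x, y, r) (1 : ℂ)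

/-- A quantum algorithm with input in `{0,1}^ℓ` and output one bit that makes `Q` quantum queries
to an oracle `{0,1}^n → {0,1}^m`: it alternates arbitrary oracle-independent unitaries
`U 0, …, U Q` with `Q` applications of the query unitary (the values `U i` for `i > Q` play no
role). -/
structure QuantumDistinguisher (n m ℓ Q : ℕ) where
  /-- number of workspace qubits -/
  w : ℕ
  /-- the unitaries applied between the queries -/
  U : ℕ → (QSpace n m ℓ w ≃ₗᵢ[ℂ] QSpace n m ℓ w)

namespace QuantumDistinguisher

variable {n m ℓ Q : ℕ}

/-- The initial state: the input register holds `g`, all other qubits are `0`. -/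
noncomputable def initState (A : QuantumDistinguisher n m ℓ Q) (g : BitStr ℓ) :
    QSpace n m ℓ A.w :=
  EuclideanSpace.single ((fun _ => false), (fun _ => false), g, (fun _ => false), false) 1

/-- The state after `i` queries (and the unitary that follows the last of them). -/
noncomputable def stateAfter (A : QuantumDistinguisher n m ℓ Q) (H : Func n m) (g : BitStr ℓ) :
    ℕ → QSpace n m ℓ A.w
  | 0 => A.U 0 (A.initState g)
  | i + 1 => A.U (i + 1) (oracleUnitary H ℓ A.w (stateAfter A H g i))

/-- The probability that `A`, on input `g` with quantum access to `H`, outputs `1`, i.e. that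
measuring the state after all `Q` queries in the computational basis yields `1` in the output
qubit. -/
noncomputable def acceptProb (A : QuantumDistinguisher n m ℓ Q) (H : Func n m) (g : BitStr ℓ) :
    ℝ :=
  ∑ b : QBasis n m ℓ A.w with b.2.2.2.2 = true, ‖A.stateAfter H g Q b‖ ^ 2

end QuantumDistinguisher

/-! ### Distinguishing advantage -/

open scoped BigOperators in
/-- The distinguishing advantage, relative to `G`, of a distinguisher that outputs `1` with
probability `acc H g` on input `g` and oracle `H`; here `𝔼` is the average over the uniform choice
of an element of a finite type. -/
noncomputable def advantage {n m k ℓ : ℕ} (G : DetAlg n m k ℓ)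
    (acc : Func n m → BitStr ℓ → ℝ) : ℝ :=
  |(𝔼 H : Func n m, 𝔼 s : BitStr k, acc H ((G s).run H)) -
    (𝔼 H : Func n m, 𝔼 g : BitStr ℓ, acc H g)|

/-- The quantum distinguishing advantage of `A` relative to `G`. -/
noncomputable def QuantumDistinguisher.adv {n m k ℓ Q : ℕ} (A : QuantumDistinguisher n m ℓ Q)
    (G : DetAlg n m k ℓ) : ℝ :=
  advantage G A.acceptProb

/-- The classical distinguishing advantage of `B` relative to `G`. -/
noncomputable def ClassicalDistinguisher.adv {n m k ℓ : ℕ} (B : ClassicalDistinguisher n m ℓ)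
    (G : DetAlg n m k ℓ) : ℝ :=
  advantage G (ClassicalDistinguisher.acceptProb B)

end LiftPRG

/-!
The classical distinguisher, on input `g`, never runs the quantum one. It learns the oracle where
the generator is likely to have looked, and then replaces the quantum algorithm by the average of
its acceptance probability over all oracles compatible with the answers.

Call `x` heavy if, given the answers so far and given that `g` is an output of the generator, the
generator queries `x` with probability at least `δ`. Heavy points are queried one after the other,
at most `T` of them. On genuine outputs each such query is, with probability at least `δ`, one of
the at most `QG` queries of the generator, so the probability that heavy points are left after `T`
queries is at most `QG / (T * δ)` (`exists_queryTree_sum_le`).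

Once no point is heavy, the oracle conditioned on `g` being an output is a uniform oracle `H'`
(subject to the known answers) reprogrammed on a random set, independent of `H'`, that contains each
point with probability at most `δ` (`sum_resample`). A quantum algorithm notices reprogramming only
through the weight with which it queries the reprogrammed points when run with `H'`
(`QuantumDistinguisher.abs_acceptProb_sub_le`); the expected total weight is at most `δ * QA`. Hence
its average acceptance probability hardly depends on `g` being an output
(`abs_sum_preimages_mul_le`). For a uniform `g` the replacement involves no error at all, because
there the unqueried values of the oracle are uniform and independent of everything known.

A final coin whose bias is the average acceptance probability can be replaced by a fixed bit, since
the advantage is linear in the biases (`exists_bit_sum_le`). So the distinguisher is even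
deterministic, and the number of its queries does not depend on `k` and `n`.
-/

namespace LiftPRG

open Finset

/-- The oracle `H'` reprogrammed to the values of `H` on `S`. -/
def splice {n m : ℕ} (S : Finset (BitStr n)) (H H' : Func n m) : Func n m :=
  fun x => if x ∈ S then H x else H' x

theorem splice_of_mem {n m : ℕ} {S : Finset (BitStr n)} {H H' : Func n m} {x : BitStr n}
    (hx : x ∈ S) : splice S H H' x = H x :=
  if_pos hx

theorem splice_of_notMem {n m : ℕ} {S : Finset (BitStr n)} {H H' : Func n m} {x : BitStr n}
    (hx : x ∉ S) : splice S H H' x = H' x :=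
  if_neg hx

/-! ### Query sets of classical computations -/

namespace QueryTree

variable {n m : ℕ} {α : Type}

/-- The set of points queried by the computation when the oracle is `H`. -/
def queried : QueryTree n m α → Func n m → Finset (BitStr n)
  | output _, _ => ∅
  | query x next, H => insert x (queried (next (H x)) H)

theorem card_queried_le (t : QueryTree n m α) (H : Func n m) :
    (t.queried H).card ≤ t.numQueries H := by
  induction t with
  | output a => simp [queried]
  | query x next ih => exact (card_insert_le _ _).trans (Nat.succ_le_succ (ih _))

theorem run_and_queried_congr (t : QueryTree n m α) {H H' : Func n m}
    (h : ∀ x ∈ t.queried H, H' x = H x) :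
    t.run H' = t.run H ∧ t.queried H' = t.queried H := by
  induction t with
  | output a => simp [run, queried]
  | query x next ih =>
    have hx : H' x = H x := h x (mem_insert_self _ _)
    have := ih (H x) fun z hz => h z (mem_insert_of_mem hz)
    simp only [run, queried, hx]
    exact ⟨this.1, by rw [this.2]⟩

theorem run_splice (t : QueryTree n m α) (H H' : Func n m) :
    t.run (splice (t.queried H) H H') = t.run H :=
  (t.run_and_queried_congr fun _ hx => splice_of_mem hx).1

theorem queried_splice (t : QueryTree n m α) (H H' : Func n m) :
    t.queried (splice (t.queried H) H H') = t.queried H :=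
  (t.run_and_queried_congr fun _ hx => splice_of_mem hx).2

end QueryTree

/-! ### Oracles with prescribed values -/

section Cube

variable {n m : ℕ}

/-- The oracles that agree with `h` on `D`: those compatible with a classical algorithm having
queried exactly the points of `D` and received the answers `h`. -/
def cube (D : Finset (BitStr n)) (h : Func n m) : Finset (Func n m) :=
  {H | ∀ x ∈ D, H x = h x}

theorem mem_cube {D : Finset (BitStr n)} {h H : Func n m} :
    H ∈ cube D h ↔ ∀ x ∈ D, H x = h x := by
  simp [cube]

theorem cube_nonempty (D : Finset (BitStr n)) (h : Func n m) : (cube D h).Nonempty :=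
  ⟨h, mem_cube.2 fun _ _ => rfl⟩

theorem splice_mem_cube {D S : Finset (BitStr n)} {h H H' : Func n m} (hH : H ∈ cube D h)
    (hH' : H' ∈ cube D h) : splice S H H' ∈ cube D h :=
  mem_cube.2 fun x hx => by
    by_cases hS : x ∈ S
    · rw [splice_of_mem hS, mem_cube.1 hH x hx]
    · rw [splice_of_notMem hS, mem_cube.1 hH' x hx]

theorem mem_cube_insert_update {D : Finset (BitStr n)} {h H : Func n m} {x : BitStr n}
    (hx : x ∉ D) (y : BitStr m) :
    H ∈ cube (insert x D) (Function.update h x y) ↔ H ∈ cube D h ∧ H x = y := by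
  rw [mem_cube, mem_cube, forall_mem_insert, Function.update_self, and_comm]
  refine and_congr_left fun _ => forall₂_congr fun z hz => ?_
  rw [Function.update_of_ne (fun e : z = x => hx (e ▸ hz))]

theorem sum_cube_split {D : Finset (BitStr n)} (h : Func n m) {x : BitStr n} (hx : x ∉ D)
    (F : Func n m → ℝ) :
    ∑ H ∈ cube D h, F H =
      ∑ y, ∑ H ∈ cube (insert x D) (Function.update h x y), F H := by
  rw [← sum_fiberwise (cube D h) (fun H => H x) F]
  refine sum_congr rfl fun y _ => sum_congr ?_ fun _ _ => rfl
  ext H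
  rw [mem_filter, mem_cube_insert_update hx]

/-- Resampling: whether the unqueried values of the oracle are its own or those of an independent
oracle makes no difference. Exchanging the unqueried values of `H` and `H'` is an involution on
pairs, because it does not change the set of queried points. -/
theorem sum_resample {α : Type} (t : QueryTree n m α) (D : Finset (BitStr n)) (h : Func n m)
    (F : α → ℝ) (f : Func n m → ℝ) :
    ∑ H ∈ cube D h, ∑ H' ∈ cube D h, F (t.run H) * f (splice (t.queried H) H H') =
      ∑ H ∈ cube D h, ∑ _H' ∈ cube D h, F (t.run H) * f H := by
  rw [← sum_product', ← sum_product']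
  let σ : Func n m × Func n m → Func n m × Func n m := fun p =>
    (splice (t.queried p.1) p.1 p.2, splice (t.queried p.1) p.2 p.1)
  have hσ : ∀ p, σ (σ p) = p := fun p => by
    simp only [σ, t.queried_splice]
    refine Prod.ext (funext fun x => ?_) (funext fun x => ?_) <;>
    by_cases hx : x ∈ t.queried p.1 <;> simp [splice, hx]
  have hm : ∀ p ∈ cube D h ×ˢ cube D h, σ p ∈ cube D h ×ˢ cube D h := fun p hp =>
    have hp := mem_product.1 hp
    mem_product.2 ⟨splice_mem_cube hp.1 hp.2, splice_mem_cube hp.2 hp.1⟩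
  refine sum_nbij' σ σ hm hm (fun p _ => hσ p) (fun p _ => hσ p) fun p _ => ?_
  simp only [σ, t.run_splice]

end Cube

/-! ### Preimages of a challenge and heavy points -/

section Heavy

variable {n m k ℓ : ℕ} (G : DetAlg n m k ℓ) (g : BitStr ℓ)

/-- The number of seeds that `G` expands to `g` when the oracle is `H`. -/
def preimages (H : Func n m) : ℝ := ∑ s, if (G s).run H = g then 1 else 0

/-- The number of seeds that `G` expands to `g` and for which it queries `x`. -/
def preimagesQuerying (x : BitStr n) (H : Func n m) : ℝ :=
  ∑ s, if (G s).run H = g then (if x ∈ (G s).queried H then 1 else 0) else 0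

/-- The number of queries outside `D` that `G` makes, in total, on the seeds that it expands
to `g`. -/
def preimageQueries (D : Finset (BitStr n)) (H : Func n m) : ℝ :=
  ∑ s, if (G s).run H = g then (((G s).queried H \ D).card : ℝ) else 0

theorem preimages_nonneg (H : Func n m) : 0 ≤ preimages G g H :=
  sum_nonneg fun _ _ => by split_ifs <;> norm_num

theorem preimageQueries_nonneg (D : Finset (BitStr n)) (H : Func n m) :
    0 ≤ preimageQueries G g D H :=
  sum_nonneg fun _ _ => by split_ifs <;> positivity

theorem preimageQueries_eq_insert {D : Finset (BitStr n)} {x : BitStr n} (hx : x ∉ D)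
    (H : Func n m) :
    preimageQueries G g D H = preimageQueries G g (insert x D) H + preimagesQuerying G g x H := by
  simp only [preimageQueries, preimagesQuerying, ← sum_add_distrib]
  refine sum_congr rfl fun s _ => ?_
  by_cases hg : (G s).run H = g
  · simp only [hg, if_true]
    by_cases hq : x ∈ (G s).queried H
    · have hx' : x ∈ (G s).queried H \ D := mem_sdiff.2 ⟨hq, hx⟩
      rw [if_pos hq, sdiff_insert, ← card_erase_add_one hx']
      push_cast
      rfl
    · rw [if_neg hq, sdiff_insert, erase_eq_of_notMem fun h => hq (mem_sdiff.1 h).1, add_zero]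
  · simp [hg]

/-- If no point outside `D` is heavy, i.e. each is queried on at most a `δ`-fraction of the pairs
of an oracle in the cube and a seed expanded to `g`, then weighting the oracles of the cube by the
number of these seeds hardly changes the average of a function `f` that is insensitive to
reprogramming the oracle at points of small mass. The mass `μ H'` refers to the oracle `H'` that is
reprogrammed, and `H'` is independent of the set of reprogrammed points. -/
theorem abs_sum_preimages_mul_le {D : Finset (BitStr n)} {h : Func n m} {δ a b : ℝ}
    {f : Func n m → ℝ} {μ : Func n m → BitStr n → ℝ} (hδ : 0 ≤ δ)
    (hμ : ∀ H x, 0 ≤ μ H x) (hμb : ∀ H, ∑ x, μ H x ≤ b)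
    (hf : ∀ (H H' : Func n m) (S : Finset (BitStr n)), (∀ x ∉ S, H x = H' x) →
      |f H - f H'| ≤ a + ∑ x ∈ S, μ H' x)
    (hlight : ∀ x ∉ D, ∑ H ∈ cube D h, preimagesQuerying G g x H ≤
      δ * ∑ H ∈ cube D h, preimages G g H) :
    |∑ H ∈ cube D h, preimages G g H * (f H - (∑ H' ∈ cube D h, f H') / (cube D h).card)| ≤
      (a + b * δ) * ∑ H ∈ cube D h, preimages G g H := by
  set C := cube D h with hC
  set R := ∑ H ∈ C, preimages G g H with hR
  have hM : (0 : ℝ) < C.card := by exact_mod_cast (cube_nonempty D h).card_pos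
  have hR0 : 0 ≤ R := sum_nonneg fun _ _ => preimages_nonneg G g _
  let e : BitStr k → Func n m → ℝ := fun s H => if (G s).run H = g then 1 else 0
  have he : ∀ s H, 0 ≤ e s H := fun s H => by simp only [e]; split_ifs <;> norm_num
  -- Average over an independent oracle `H'`, with the queried values taken from `H`.
  have key : (C.card : ℝ) * ∑ H ∈ C, preimages G g H * (f H - (∑ H' ∈ C, f H') / C.card) =
      ∑ s, ∑ H ∈ C, ∑ H' ∈ C, e s H * (f (splice ((G s).queried H) H H') - f H') := by
    have h1 : ∀ s, ∑ H ∈ C, ∑ H' ∈ C, e s H * (f (splice ((G s).queried H) H H') - f H') =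
        ∑ H ∈ C, e s H * (C.card * f H - ∑ H' ∈ C, f H') := fun s => by
      simp only [mul_sub, sum_sub_distrib, ← mul_sum]
      have := sum_resample (G s) D h (fun o => if o = g then 1 else 0) f
      simp only [sum_const, nsmul_eq_mul, ← hC, ← mul_sum] at this
      rw [this, mul_sum]
      simp only [e]
      congr 1
      exact sum_congr rfl fun _ _ => by ring
    rw [sum_congr rfl fun s _ => h1 s, sum_comm, mul_sum]
    refine sum_congr rfl fun H _ => ?_
    rw [← sum_mul]
    simp only [preimages, e]
    field_simp
  have bound : ∀ s, ∀ H ∈ C, ∀ H' ∈ C,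
      |e s H * (f (splice ((G s).queried H) H H') - f H')| ≤
        e s H * a + ∑ x ∈ univ \ D, μ H' x * (e s H * if x ∈ (G s).queried H then 1 else 0) := by
    intro s H hH H' hH'
    rw [abs_mul, abs_of_nonneg (he s H)]
    have := hf (splice ((G s).queried H) H H') H' ((G s).queried H \ D) fun x hx => by
      by_cases hq : x ∈ (G s).queried H
      · have hxD : x ∈ D := by simpa [hq] using hx
        rw [splice_of_mem hq, mem_cube.1 hH x hxD, mem_cube.1 hH' x hxD]
      · rw [splice_of_notMem hq]
    refine (mul_le_mul_of_nonneg_left this (he s H)).trans_eq ?_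
    rw [mul_add, mul_sum]
    congr 1
    rw [← sum_subset (sdiff_subset_sdiff (subset_univ ((G s).queried H)) (Subset.refl D))]
    · refine sum_congr rfl fun x hx => ?_
      rw [if_pos (mem_sdiff.1 hx).1]; ring
    · intro x hx hx'
      have : x ∉ (G s).queried H := fun hq => hx' (mem_sdiff.2 ⟨hq, (mem_sdiff.1 hx).2⟩)
      simp [this]
  have hlight' : ∀ x ∉ D, ∑ s, ∑ H ∈ C, e s H * (if x ∈ (G s).queried H then 1 else 0) ≤
      δ * R := fun x hx => by
    refine le_of_eq_of_le ?_ (hlight x hx)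
    rw [sum_comm]
    simp only [preimagesQuerying, e, ite_mul, one_mul, zero_mul]
  have hRe : ∑ s, ∑ H ∈ C, e s H = R := by rw [sum_comm]; rfl
  have total : (C.card : ℝ) *
      |∑ H ∈ C, preimages G g H * (f H - (∑ H' ∈ C, f H') / C.card)| ≤
        C.card * ((a + b * δ) * R) := by
    rw [← abs_of_pos hM, ← abs_mul, abs_of_pos hM, key]
    calc _ ≤ ∑ s, ∑ H ∈ C, ∑ H' ∈ C, (e s H * a +
          ∑ x ∈ univ \ D, μ H' x * (e s H * if x ∈ (G s).queried H then 1 else 0)) :=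
          (abs_sum_le_sum_abs _ _).trans <| sum_le_sum fun s _ =>
            (abs_sum_le_sum_abs _ _).trans <| sum_le_sum fun H hH =>
              (abs_sum_le_sum_abs _ _).trans <| sum_le_sum fun H' hH' => bound s H hH H' hH'
      _ = ∑ H' ∈ C, ((∑ s, ∑ H ∈ C, e s H) * a + ∑ x ∈ univ \ D, μ H' x *
            ∑ s, ∑ H ∈ C, (e s H * if x ∈ (G s).queried H then 1 else 0)) := by
          rw [sum_congr rfl fun s _ => sum_comm, sum_comm]
          refine sum_congr rfl fun H' _ => ?_
          simp only [sum_add_distrib, sum_mul, mul_sum]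
          congr 1
          rw [sum_congr rfl fun s _ => sum_comm, sum_comm]
      _ ≤ ∑ H' ∈ C, (a + b * δ) * R := sum_le_sum fun H' _ => by
          have h1 : ∑ x ∈ univ \ D, μ H' x *
              ∑ s, ∑ H ∈ C, (e s H * if x ∈ (G s).queried H then 1 else 0) ≤
                ∑ x ∈ univ \ D, μ H' x * (δ * R) :=
            sum_le_sum fun x hx => mul_le_mul_of_nonneg_left
              (hlight' x (mem_sdiff.1 hx).2) (hμ H' x)
          have h2 : ∑ x ∈ univ \ D, μ H' x ≤ b :=
            (sum_le_sum_of_subset_of_nonneg (subset_univ _) fun x _ _ => hμ H' x).trans (hμb H')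
          rw [← sum_mul] at h1
          have h3 := mul_le_mul_of_nonneg_right h2 (mul_nonneg hδ hR0)
          rw [hRe]
          linarith
      _ = _ := by rw [sum_const, nsmul_eq_mul]
  exact le_of_mul_le_mul_left total hM

theorem sum_preimages_mul (f : BitStr ℓ → ℝ) (H : Func n m) :
    ∑ g, preimages G g H * f g = ∑ s, f ((G s).run H) := by
  simp only [preimages, sum_mul, ite_mul, one_mul, zero_mul]
  rw [sum_comm]
  simp

theorem sum_preimages (H : Func n m) : ∑ g, preimages G g H = 2 ^ k := by
  simpa using sum_preimages_mul G (fun _ => 1) H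

theorem sum_preimageQueries_le {q : ℕ} (hG : G.MakesAtMost q) (D : Finset (BitStr n))
    (H : Func n m) : ∑ g, preimageQueries G g D H ≤ q * 2 ^ k := by
  simp only [preimageQueries]
  rw [sum_comm]
  calc _ ≤ ∑ _s : BitStr k, (q : ℝ) := sum_le_sum fun s _ => by
          simp only [sum_ite_eq, mem_univ, if_true]
          exact_mod_cast (card_le_card sdiff_subset).trans
            (((G s).card_queried_le H).trans (hG s H))
    _ = _ := by simp [mul_comm]

end Heavy

/-! ### Querying the heavy points -/

section Simulation

variable {n m k ℓ : ℕ} (G : DetAlg n m k ℓ) (g : BitStr ℓ)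

/-- A bit as a real number. -/
def bit (b : Bool) : ℝ := if b then 1 else 0

/-- Answering with the better one of the two bits is at least as good as answering with a coin
whose bias is the average of `f`, and the coin is exact for the part `c` of the weights that does
not depend on the oracle. -/
theorem exists_bit_sum_le {C : Finset (Func n m)} (hC : C.Nonempty) {f : Func n m → ℝ}
    (hf : ∀ H, 0 ≤ f H ∧ f H ≤ 1) (P : Func n m → ℝ) {σ : ℝ} (hσ : |σ| = 1) (c : ℝ) :
    ∃ b : Bool, ∑ H ∈ C, σ * (P H - c) * (f H - bit b) ≤
      |∑ H ∈ C, P H * (f H - (∑ H' ∈ C, f H') / C.card)| := by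
  have hM : (0 : ℝ) < C.card := by exact_mod_cast hC.card_pos
  set v := (∑ H' ∈ C, f H') / C.card with hv
  have hv0 : 0 ≤ v := div_nonneg (sum_nonneg fun H _ => (hf H).1) hM.le
  have hv1 : v ≤ 1 := (div_le_one hM).2 <| by
    simpa using sum_le_sum fun H (_ : H ∈ C) => (hf H).2
  have hsum : ∑ H ∈ C, (f H - v) = 0 := by
    rw [sum_sub_distrib, sum_const, nsmul_eq_mul, hv]
    field_simp
    ring
  have hcoin : ∑ H ∈ C, σ * (P H - c) * (f H - v) = σ * ∑ H ∈ C, P H * (f H - v) := by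
    have : ∑ H ∈ C, σ * (P H - c) * (f H - v) =
        σ * ∑ H ∈ C, P H * (f H - v) - σ * c * ∑ H ∈ C, (f H - v) := by
      rw [mul_sum, mul_sum, ← sum_sub_distrib]
      exact sum_congr rfl fun _ _ => by ring
    rw [this, hsum, mul_zero, sub_zero]
  have habs : σ * ∑ H ∈ C, P H * (f H - v) ≤ |∑ H ∈ C, P H * (f H - v)| := by
    refine (le_abs_self _).trans_eq ?_
    rw [abs_mul, hσ, one_mul]
  have hbit : ∀ b, ∑ H ∈ C, σ * (P H - c) * (f H - bit b) =
      ∑ H ∈ C, σ * (P H - c) * (f H - v) + (v - bit b) * ∑ H ∈ C, σ * (P H - c) := fun b => by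
    rw [mul_sum, ← sum_add_distrib]
    exact sum_congr rfl fun _ _ => by ring
  rcases le_total 0 (∑ H ∈ C, σ * (P H - c)) with hw | hw
  · refine ⟨true, ?_⟩
    rw [hbit, hcoin]
    have : (v - bit true) * ∑ H ∈ C, σ * (P H - c) ≤ 0 :=
      mul_nonpos_of_nonpos_of_nonneg (by simpa [bit] using hv1) hw
    linarith
  · refine ⟨false, ?_⟩
    rw [hbit, hcoin]
    have : (v - bit false) * ∑ H ∈ C, σ * (P H - c) ≤ 0 :=
      mul_nonpos_of_nonneg_of_nonpos (by simpa [bit] using hv0) hw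
    linarith

/-- The computation that queries heavy points one after the other, at most `j` of them, and answers
with the better bit when none is left or `j` queries are made. Each heavy query uses up at least a
`δ`-fraction of the preimages from the total number of queries that `G` makes on the preimages, so
the preimages for which heavy points are left after `j` queries weigh at most
`(∑ preimageQueries) / (j * δ)`. -/
theorem exists_queryTree_sum_le {f : Func n m → ℝ} (hf : ∀ H, 0 ≤ f H ∧ f H ≤ 1) {δ η : ℝ}
    (hδ : 0 ≤ δ) (hη : 0 ≤ η)
    (hlight : ∀ (D : Finset (BitStr n)) (h : Func n m),
      (∀ x ∉ D, ∑ H ∈ cube D h, preimagesQuerying G g x H ≤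
        δ * ∑ H ∈ cube D h, preimages G g H) →
      |∑ H ∈ cube D h, preimages G g H * (f H - (∑ H' ∈ cube D h, f H') / (cube D h).card)| ≤
        η * ∑ H ∈ cube D h, preimages G g H)
    {σ : ℝ} (hσ : |σ| = 1) (c : ℝ) (j : ℕ) (D : Finset (BitStr n)) (h : Func n m) :
    ∃ t : QueryTree n m Bool, (∀ H, t.numQueries H ≤ j) ∧
      ∑ H ∈ cube D h, σ * (preimages G g H - c) * (f H - bit (t.run H)) ≤
        ∑ H ∈ cube D h, preimages G g H ∧
      j * δ * (∑ H ∈ cube D h, σ * (preimages G g H - c) * (f H - bit (t.run H)) -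
        η * ∑ H ∈ cube D h, preimages G g H) ≤ ∑ H ∈ cube D h, preimageQueries G g D H := by
  have hN : ∀ (D : Finset (BitStr n)) (h : Func n m),
      0 ≤ ∑ H ∈ cube D h, preimageQueries G g D H :=
    fun D h => sum_nonneg fun _ _ => preimageQueries_nonneg G g D _
  have hle : ∀ (D : Finset (BitStr n)) (h : Func n m),
      |∑ H ∈ cube D h, preimages G g H * (f H - (∑ H' ∈ cube D h, f H') / (cube D h).card)| ≤
        ∑ H ∈ cube D h, preimages G g H := fun D h => by
    have hM : (0 : ℝ) < (cube D h).card := by exact_mod_cast (cube_nonempty D h).card_pos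
    have hv0 : 0 ≤ (∑ H' ∈ cube D h, f H') / (cube D h).card :=
      div_nonneg (sum_nonneg fun H _ => (hf H).1) hM.le
    have hv1 : (∑ H' ∈ cube D h, f H') / (cube D h).card ≤ 1 := (div_le_one hM).2 <| by
      simpa using sum_le_sum fun H (_ : H ∈ cube D h) => (hf H).2
    refine (abs_sum_le_sum_abs _ _).trans (sum_le_sum fun H _ => ?_)
    rw [abs_mul, abs_of_nonneg (preimages_nonneg G g H)]
    refine mul_le_of_le_one_right (preimages_nonneg G g H) (abs_le.2 ⟨?_, ?_⟩) <;>
    linarith [(hf H).1, (hf H).2]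
  induction j generalizing D h with
  | zero =>
    obtain ⟨b, hb⟩ := exists_bit_sum_le (cube_nonempty D h) hf (preimages G g) hσ c
    refine ⟨.output b, fun _ => le_rfl, hb.trans (hle D h), ?_⟩
    simpa using hN D h
  | succ j ih =>
    by_cases hL : ∀ x ∉ D, ∑ H ∈ cube D h, preimagesQuerying G g x H ≤
        δ * ∑ H ∈ cube D h, preimages G g H
    · obtain ⟨b, hb⟩ := exists_bit_sum_le (cube_nonempty D h) hf (preimages G g) hσ c
      refine ⟨.output b, fun _ => Nat.zero_le _, hb.trans (hle D h), ?_⟩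
      refine (mul_nonpos_of_nonneg_of_nonpos (by positivity) ?_).trans (hN D h)
      exact sub_nonpos.2 (hb.trans (hlight D h hL))
    · push Not at hL
      obtain ⟨x, hx, hheavy⟩ := hL
      choose t htq htR htN using fun y => ih (insert x D) (Function.update h x y)
      have hrun : ∀ y, ∀ H ∈ cube (insert x D) (Function.update h x y),
          (QueryTree.query x t).run H = (t y).run H := fun y H hH => by
        rw [QueryTree.run, ((mem_cube_insert_update hx y).1 hH).2]
      have hE : ∑ H ∈ cube D h, σ * (preimages G g H - c) *
          (f H - bit ((QueryTree.query x t).run H)) =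
          ∑ y, ∑ H ∈ cube (insert x D) (Function.update h x y),
            σ * (preimages G g H - c) * (f H - bit ((t y).run H)) := by
        rw [sum_cube_split h hx]
        exact sum_congr rfl fun y _ => sum_congr rfl fun H hH => by rw [hrun y H hH]
      have hR : ∑ H ∈ cube D h, σ * (preimages G g H - c) *
          (f H - bit ((QueryTree.query x t).run H)) ≤ ∑ H ∈ cube D h, preimages G g H := by
        rw [hE, sum_cube_split h hx (preimages G g)]
        exact sum_le_sum fun y _ => htR y
      refine ⟨.query x t, fun H => Nat.succ_le_succ (htq _ H), hR, ?_⟩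
      have hIH := sum_le_sum fun y (_ : y ∈ univ) => htN y
      rw [← mul_sum, sum_sub_distrib, ← mul_sum, ← hE, ← sum_cube_split h hx,
        ← sum_cube_split h hx] at hIH
      have hsplit : ∑ H ∈ cube D h, preimageQueries G g D H =
          ∑ H ∈ cube D h, preimageQueries G g (insert x D) H +
            ∑ H ∈ cube D h, preimagesQuerying G g x H := by
        rw [← sum_add_distrib]
        exact sum_congr rfl fun H _ => preimageQueries_eq_insert G g hx H
      have hηR : 0 ≤ η * ∑ H ∈ cube D h, preimages G g H :=
        mul_nonneg hη (sum_nonneg fun _ _ => preimages_nonneg G g _)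
      have hstep := mul_le_mul_of_nonneg_left ((sub_le_self _ hηR).trans hR) hδ
      rw [hsplit]
      push_cast
      linarith

end Simulation

/-! ### Reprogramming the oracle of a quantum algorithm -/

section Quantum

variable {n m ℓ w : ℕ}

/-- The weight of the part of the state whose query register holds `x`. -/
noncomputable def queryWeight (ψ : QSpace n m ℓ w) (x : BitStr n) : ℝ :=
  ∑ b : QBasis n m ℓ w with b.1 = x, ‖ψ b‖ ^ 2

theorem queryWeight_nonneg (ψ : QSpace n m ℓ w) (x : BitStr n) : 0 ≤ queryWeight ψ x :=
  sum_nonneg fun _ _ => sq_nonneg _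

theorem sum_queryWeight (ψ : QSpace n m ℓ w) : ∑ x, queryWeight ψ x = ‖ψ‖ ^ 2 := by
  rw [EuclideanSpace.norm_sq_eq]
  exact sum_fiberwise univ (fun b : QBasis n m ℓ w => b.1) fun b => ‖ψ b‖ ^ 2

theorem sum_finset_queryWeight (ψ : QSpace n m ℓ w) (S : Finset (BitStr n)) :
    ∑ x ∈ S, queryWeight ψ x = ∑ b : QBasis n m ℓ w with b.1 ∈ S, ‖ψ b‖ ^ 2 := by
  simp only [queryWeight, sum_filter]
  rw [sum_comm]
  exact sum_congr rfl fun b _ => by simp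

theorem oracleUnitary_apply (H : Func n m) (ψ : QSpace n m ℓ w) (b : QBasis n m ℓ w) :
    oracleUnitary H ℓ w ψ b = ψ (oraclePerm H ℓ w b) := rfl

theorem sum_norm_sq_oracleUnitary (H : Func n m) (ψ : QSpace n m ℓ w) (S : Finset (BitStr n)) :
    ∑ b : QBasis n m ℓ w with b.1 ∈ S, ‖oracleUnitary H ℓ w ψ b‖ ^ 2 =
      ∑ x ∈ S, queryWeight ψ x := by
  rw [sum_finset_queryWeight, sum_filter, sum_filter]
  exact Equiv.sum_comp (oraclePerm H ℓ w) fun b => if b.1 ∈ S then ‖ψ b‖ ^ 2 else 0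

theorem norm_oracleUnitary_sub_sq_le {H H' : Func n m} {S : Finset (BitStr n)}
    (hS : ∀ x ∉ S, H x = H' x) (ψ : QSpace n m ℓ w) :
    ‖oracleUnitary H ℓ w ψ - oracleUnitary H' ℓ w ψ‖ ^ 2 ≤ 4 * ∑ x ∈ S, queryWeight ψ x := by
  rw [EuclideanSpace.norm_sq_eq]
  calc _ = ∑ b : QBasis n m ℓ w with b.1 ∈ S,
          ‖oracleUnitary H ℓ w ψ b - oracleUnitary H' ℓ w ψ b‖ ^ 2 := by
        rw [sum_filter]
        refine sum_congr rfl fun b _ => ?_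
        split_ifs with hb
        · rfl
        · simp [oracleUnitary_apply, oraclePerm, hS _ hb]
    _ ≤ ∑ b : QBasis n m ℓ w with b.1 ∈ S,
          (2 * ‖oracleUnitary H ℓ w ψ b‖ ^ 2 + 2 * ‖oracleUnitary H' ℓ w ψ b‖ ^ 2) :=
        sum_le_sum fun b _ => by
          have h1 := norm_sub_le (oracleUnitary H ℓ w ψ b) (oracleUnitary H' ℓ w ψ b)
          have h2 := pow_le_pow_left₀ (norm_nonneg _) h1 2
          linarith [sq_nonneg (‖oracleUnitary H ℓ w ψ b‖ - ‖oracleUnitary H' ℓ w ψ b‖)]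
    _ = _ := by
        rw [sum_add_distrib, ← mul_sum, ← mul_sum, sum_norm_sq_oracleUnitary,
          sum_norm_sq_oracleUnitary]
        ring

/-- The free parameter `r` replaces the square root of the query weight, so that the bound is linear
in the weight and can be averaged. -/
theorem norm_oracleUnitary_sub_le {H H' : Func n m} {S : Finset (BitStr n)}
    (hS : ∀ x ∉ S, H x = H' x) (ψ : QSpace n m ℓ w) {r : ℝ} (hr : 0 < r) :
    ‖oracleUnitary H ℓ w ψ - oracleUnitary H' ℓ w ψ‖ ≤ r + (∑ x ∈ S, queryWeight ψ x) / r := by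
  have h := norm_oracleUnitary_sub_sq_le hS ψ
  set d := ‖oracleUnitary H ℓ w ψ - oracleUnitary H' ℓ w ψ‖
  rw [← sub_le_iff_le_add', le_div_iff₀ hr]
  linarith [sq_nonneg (d - 2 * r)]

/-- The probabilities that a measurement outcome lies in `s` differ by at most twice the distance of
the two measured states. -/
theorem abs_sum_norm_sq_sub_le {ι : Type*} [Fintype ι] {φ ψ : EuclideanSpace ℂ ι}
    (hφ : ‖φ‖ = 1) (hψ : ‖ψ‖ = 1) (s : Finset ι) :
    |∑ b ∈ s, ‖φ b‖ ^ 2 - ∑ b ∈ s, ‖ψ b‖ ^ 2| ≤ 2 * ‖φ - ψ‖ := by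
  classical
  let P : EuclideanSpace ℂ ι → EuclideanSpace ℂ ι := fun φ =>
    WithLp.toLp 2 fun b => if b ∈ s then φ b else 0
  have hP : ∀ φ, ‖P φ‖ ^ 2 = ∑ b ∈ s, ‖φ b‖ ^ 2 := fun φ => by
    rw [EuclideanSpace.norm_sq_eq]
    simp only [P, apply_ite norm, norm_zero, ite_pow, ne_eq, OfNat.ofNat_ne_zero,
      not_false_eq_true, zero_pow]
    rw [sum_ite_mem, univ_inter]
  have hle : ∀ φ, ‖P φ‖ ≤ ‖φ‖ := fun φ => by
    refine (sq_le_sq₀ (norm_nonneg _) (norm_nonneg _)).1 ?_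
    rw [hP, EuclideanSpace.norm_sq_eq]
    exact sum_le_sum_of_subset_of_nonneg (subset_univ _) fun _ _ _ => sq_nonneg _
  have hsub : P φ - P ψ = P (φ - ψ) := by
    ext b
    by_cases hb : b ∈ s <;> simp [P, hb]
  have h1 : |‖P φ‖ - ‖P ψ‖| ≤ ‖φ - ψ‖ :=
    (abs_norm_sub_norm_le _ _).trans (hsub ▸ hle _)
  have h2 : ‖P φ‖ + ‖P ψ‖ ≤ 2 := by linarith [hle φ, hle ψ]
  rw [← hP, ← hP, sq_sub_sq, abs_mul, abs_of_nonneg (by positivity)]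
  exact mul_le_mul h2 h1 (abs_nonneg _) (by norm_num)

namespace QuantumDistinguisher

variable {Q : ℕ} (A : QuantumDistinguisher n m ℓ Q) (g : BitStr ℓ)

theorem norm_stateAfter (H : Func n m) (i : ℕ) : ‖A.stateAfter H g i‖ = 1 := by
  induction i with
  | zero => simp [stateAfter, initState]
  | succ i ih => simp [stateAfter, ih]

theorem acceptProb_nonneg (H : Func n m) : 0 ≤ A.acceptProb H g :=
  sum_nonneg fun _ _ => sq_nonneg _

theorem acceptProb_le_one (H : Func n m) : A.acceptProb H g ≤ 1 := by
  have h : ‖A.stateAfter H g Q‖ ^ 2 = 1 := by rw [A.norm_stateAfter, one_pow]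
  rw [EuclideanSpace.norm_sq_eq] at h
  rw [← h]
  exact sum_le_sum_of_subset_of_nonneg (subset_univ _) fun _ _ _ => sq_nonneg _

/-- The total weight with which the `Q` queries of `A` are made at `x`. -/
noncomputable def totalQueryWeight (H : Func n m) (x : BitStr n) : ℝ :=
  ∑ i ∈ range Q, queryWeight (A.stateAfter H g i) x

theorem totalQueryWeight_nonneg (H : Func n m) (x : BitStr n) :
    0 ≤ A.totalQueryWeight g H x :=
  sum_nonneg fun _ _ => queryWeight_nonneg _ x

theorem sum_totalQueryWeight (H : Func n m) : ∑ x, A.totalQueryWeight g H x = Q := by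
  simp only [totalQueryWeight]
  rw [sum_comm]
  simp [sum_queryWeight, norm_stateAfter]

theorem norm_stateAfter_sub_le {H H' : Func n m} {S : Finset (BitStr n)}
    (hS : ∀ x ∉ S, H x = H' x) {r : ℝ} (hr : 0 < r) (i : ℕ) :
    ‖A.stateAfter H g i - A.stateAfter H' g i‖ ≤
      ∑ j ∈ range i, (r + (∑ x ∈ S, queryWeight (A.stateAfter H' g j) x) / r) := by
  induction i with
  | zero => simp [stateAfter]
  | succ i ih =>
    rw [stateAfter, stateAfter, ← map_sub, LinearIsometryEquiv.norm_map, sum_range_succ]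
    refine (norm_sub_le_norm_sub_add_norm_sub _
      (oracleUnitary H ℓ A.w (A.stateAfter H' g i)) _).trans (add_le_add ?_ ?_)
    · rwa [← map_sub, LinearIsometryEquiv.norm_map]
    · exact norm_oracleUnitary_sub_le hS _ hr

/-- Reprogramming the oracle on `S` matters only as far as `A` queries `S` when run with the
original oracle `H'`. -/
theorem abs_acceptProb_sub_le {r : ℝ} (hr : 0 < r) (H H' : Func n m) (S : Finset (BitStr n))
    (hS : ∀ x ∉ S, H x = H' x) :
    |A.acceptProb H g - A.acceptProb H' g| ≤
      2 * Q * r + ∑ x ∈ S, 2 / r * A.totalQueryWeight g H' x := by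
  have h1 := abs_sum_norm_sq_sub_le (A.norm_stateAfter g H Q) (A.norm_stateAfter g H' Q)
    ({b | b.2.2.2.2 = true} : Finset (QBasis n m ℓ A.w))
  have h2 := A.norm_stateAfter_sub_le g hS hr Q
  rw [sum_add_distrib, ← sum_div, sum_comm, sum_const, card_range, nsmul_eq_mul] at h2
  rw [← mul_sum]
  refine h1.trans ((mul_le_mul_of_nonneg_left h2 zero_le_two).trans_eq ?_)
  simp only [totalQueryWeight]
  ring

end QuantumDistinguisher

end Quantum

/-! ### The advantage of the simulation -/

section Advantage

variable {n m k ℓ : ℕ}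

theorem advantage_eq (G : DetAlg n m k ℓ) (acc : Func n m → BitStr ℓ → ℝ) :
    advantage G acc =
      |∑ g, ∑ H, (preimages G g H - 2 ^ k / 2 ^ ℓ) * acc H g| /
        (Fintype.card (Func n m) * 2 ^ k) := by
  have hF : (0 : ℝ) < Fintype.card (Func n m) := by exact_mod_cast Fintype.card_pos
  rw [← abs_of_pos (mul_pos hF (pow_pos two_pos k)), ← abs_div, advantage]
  congr 1
  have h1 : ∑ g, ∑ H, (preimages G g H - 2 ^ k / 2 ^ ℓ) * acc H g =
      ∑ H, ∑ s, acc H ((G s).run H) - 2 ^ k / 2 ^ ℓ * ∑ H, ∑ g, acc H g := by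
    rw [sum_comm, mul_sum, ← sum_sub_distrib]
    refine sum_congr rfl fun H _ => ?_
    simp only [sub_mul, sum_sub_distrib, sum_preimages_mul, mul_sum]
  rw [h1]
  simp only [Fintype.expect_eq_sum_div_card, ← sum_div]
  have hk : (Fintype.card (BitStr k) : ℝ) = 2 ^ k := by simp
  have hl : (Fintype.card (BitStr ℓ) : ℝ) = 2 ^ ℓ := by simp
  rw [hk, hl]
  field_simp

theorem acceptProb_pure (t : BitStr ℓ → QueryTree n m Bool) (H : Func n m) (g : BitStr ℓ) :
    ClassicalDistinguisher.acceptProb (fun g => PMF.pure (t g)) H g = bit ((t g).run H) := by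
  rw [ClassicalDistinguisher.acceptProb, PMF.pure_map, PMF.pure_apply, bit]
  cases (t g).run H <;> simp

/-- The classical simulation with `T` queries, where points are heavy above the threshold `r ^ 2`:
the first loss comes from reprogramming at light points, the second from running out of queries. -/
theorem exists_classicalDistinguisher {QG QA : ℕ} {G : DetAlg n m k ℓ} (hG : G.MakesAtMost QG)
    (A : QuantumDistinguisher n m ℓ QA) {r : ℝ} (hr : 0 < r) {T : ℕ} (hT : 0 < T) :
    ∃ B : ClassicalDistinguisher n m ℓ, B.MakesAtMost T ∧
      A.adv G - 4 * QA * r - QG / (T * r ^ 2) ≤ B.adv G := by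
  set c : ℝ := 2 ^ k / 2 ^ ℓ with hc
  set Z : ℝ := Fintype.card (Func n m) * 2 ^ k with hZ
  have hF : (0 : ℝ) < Fintype.card (Func n m) := by exact_mod_cast Fintype.card_pos
  have hZ0 : 0 < Z := mul_pos hF (pow_pos two_pos k)
  have hTr : 0 < T * r ^ 2 := by positivity
  set Δ : ℝ := ∑ g, ∑ H, (preimages G g H - c) * A.acceptProb H g with hΔ
  obtain ⟨σ, hσ, hσΔ⟩ : ∃ σ : ℝ, |σ| = 1 ∧ σ * Δ = |Δ| := by
    rcases le_total 0 Δ with h | h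
    · exact ⟨1, abs_one, by rw [abs_of_nonneg h, one_mul]⟩
    · exact ⟨-1, by simp, by rw [abs_of_nonpos h]; ring⟩
  have huniv : cube (∅ : Finset (BitStr n)) (fun _ _ => false : Func n m) = univ := by
    ext; simp [mem_cube]
  -- A point is heavy above the threshold `r ^ 2`, which balances the two terms of
  -- `abs_acceptProb_sub_le`.
  have htree := fun g => exists_queryTree_sum_le G g (f := fun H => A.acceptProb H g)
    (fun H => ⟨A.acceptProb_nonneg g H, A.acceptProb_le_one g H⟩) (sq_nonneg r)
    (η := 4 * QA * r) (by positivity)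
    (fun D h hlight => (abs_sum_preimages_mul_le G g (sq_nonneg r)
      (fun H x => mul_nonneg (div_nonneg zero_le_two hr.le) (A.totalQueryWeight_nonneg g H x))
      (fun H => (by rw [← mul_sum, A.sum_totalQueryWeight g H] :
        ∑ x, 2 / r * A.totalQueryWeight g H x = 2 / r * QA).le)
      (A.abs_acceptProb_sub_le g hr) hlight).trans_eq (by field_simp; ring))
    hσ c T ∅ (fun _ _ => false)
  simp only [huniv] at htree
  choose t htq _ htN using htree
  refine ⟨fun g => PMF.pure (t g), fun g u hu H => ?_, ?_⟩
  · rw [PMF.support_pure, Set.mem_singleton_iff] at hu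
    exact hu ▸ htq g H
  have hR : ∑ g, ∑ H, preimages G g H = Z := by
    rw [sum_comm, sum_congr rfl fun H _ => sum_preimages G H]
    simp [hZ]
  have hN : ∑ g, ∑ H, preimageQueries G g ∅ H ≤ QG * Z := by
    rw [sum_comm]
    refine (sum_le_sum fun H _ => sum_preimageQueries_le G hG ∅ H).trans_eq ?_
    rw [sum_const, card_univ, nsmul_eq_mul, hZ]
    ring
  set Δ' : ℝ := ∑ g, ∑ H, (preimages G g H - c) * bit ((t g).run H) with hΔ'
  have hdiff : ∑ g, ∑ H, σ * (preimages G g H - c) *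
      (A.acceptProb H g - bit ((t g).run H)) = |Δ| - σ * Δ' := by
    rw [← hσΔ, ← mul_sub, hΔ, hΔ', ← sum_sub_distrib, mul_sum]
    refine sum_congr rfl fun g _ => ?_
    rw [← sum_sub_distrib, mul_sum]
    exact sum_congr rfl fun H _ => by ring
  have hsum := (sum_le_sum fun g (_ : g ∈ univ) => htN g).trans hN
  rw [← mul_sum, sum_sub_distrib, ← mul_sum, hR, hdiff, ← le_div_iff₀' hTr] at hsum
  have hσΔ' : σ * Δ' ≤ |Δ'| := (le_abs_self _).trans_eq (by rw [abs_mul, hσ, one_mul])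
  rw [QuantumDistinguisher.adv, ClassicalDistinguisher.adv, advantage_eq, advantage_eq]
  simp only [acceptProb_pure]
  rw [← hc, ← hZ, ← hΔ, ← hΔ', le_div_iff₀ hZ0]
  have : (|Δ| / Z - 4 * QA * r - QG / (T * r ^ 2)) * Z =
      |Δ| - 4 * QA * r * Z - QG * Z / (T * r ^ 2) := by
    field_simp
  rw [this]
  linarith

end Advantage

end LiftPRG

theorem mainTheorem1 :
    ∃ p : MvPolynomial (Fin 5) ℝ,
      ∀ (k ℓ n m QG QA : ℕ) (G : LiftPRG.DetAlg n m k ℓ)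
        (A : LiftPRG.QuantumDistinguisher n m ℓ QA) (ε : ℝ),
        LiftPRG.DetAlg.MakesAtMost G QG →
        ε = LiftPRG.QuantumDistinguisher.adv A G →
        0 < ε →
        ∃ (B : LiftPRG.ClassicalDistinguisher n m ℓ) (q : ℕ),
          LiftPRG.ClassicalDistinguisher.MakesAtMost B q ∧
          (q : ℝ) ≤ MvPolynomial.eval ![(k : ℝ), (n : ℝ), (QG : ℝ), (QA : ℝ), 1 / ε] p ∧
          ε / 2 ≤ LiftPRG.ClassicalDistinguisher.adv B G := by
  refine ⟨MvPolynomial.C 1024 * MvPolynomial.X 2 * (MvPolynomial.X 3 + 1) ^ 2 *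
    MvPolynomial.X 4 ^ 3 + MvPolynomial.C 2, fun k ℓ n m QG QA G A ε hG hε hε0 => ?_⟩
  -- With `r = ε / (16 * (QA + 1))` and `T ≥ 4 * QG / (ε * r ^ 2)` either loss is at most `ε / 4`.
  have hQA : (0 : ℝ) < QA + 1 := by positivity
  obtain ⟨r, hr⟩ : ∃ r : ℝ, r = ε / (16 * (QA + 1)) := ⟨_, rfl⟩
  have hr0 : 0 < r := hr ▸ by positivity
  obtain ⟨T, hT⟩ : ∃ T : ℕ, T = ⌈4 * QG / (ε * r ^ 2)⌉₊ + 1 := ⟨_, rfl⟩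
  have hTge : 4 * QG / (ε * r ^ 2) ≤ T := by
    rw [hT]; push_cast
    exact (Nat.le_ceil _).trans (by linarith)
  have hTle : (T : ℝ) ≤ 4 * QG / (ε * r ^ 2) + 2 := by
    rw [hT]; push_cast
    linarith [Nat.ceil_lt_add_one (a := 4 * (QG : ℝ) / (ε * r ^ 2)) (by positivity)]
  have hT0 : 0 < T := hT ▸ Nat.succ_pos _
  obtain ⟨B, hB, hadv⟩ := LiftPRG.exists_classicalDistinguisher hG A hr0 hT0
  refine ⟨B, T, hB, ?_, ?_⟩
  · refine hTle.trans_eq ?_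
    simp only [map_add, map_mul, map_pow, MvPolynomial.eval_C, MvPolynomial.eval_X, map_one]
    simp only [Matrix.cons_val]
    rw [hr]
    field_simp
    ring
  · rw [← hε] at hadv
    have h1 : 4 * QA * r ≤ ε / 4 := by
      rw [hr, mul_div_assoc', div_le_div_iff₀ (by positivity) (by norm_num)]
      linarith
    have h2 : QG / (T * r ^ 2) ≤ ε / 4 := by
      rw [div_le_iff₀ (by positivity)] at hTge ⊢
      linarith
    linarith
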